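/- Let $(A,\mathfrak m)$ be a Noetherian local ring with infinite residue field, $M$ a finitely generated $A$-module with $\dim M=d>0$, $J$ an $\mathfrak m$-primary ideal, and $I_1,\dots,I_s$ ideals of $A$. *Definitions.* Let $\mathcal I=(I_1,\dots,I_r)$ be a family of ideals and $N$ an $A$-module. An element $x\in I_i$ is *Rees superficial for the index $i$* with respect to $N$ if $$xN\cap I_1^{n_1}\cdots I_i^{n_i+1}\cdots I_r^{n_r}N=x\,I_1^{n_1}\cdots I_i^{n_i}\cdots I_r^{n_r}N$$ for all $n_i\gg 0$ and all $n_l\ge 0$ $(l\ne i)$. It is a *Rees superficial element* of $\mathcal I$ with respect to $N$ if it is so for some index. A sequence $x_1,\dots,x_t$ is a *Rees superficial sequence* of $\mathcal I$ with respect to $N$ if each $x_j$ is a Rees superficial element of $\mathcal I$ with respect to $N/(x_1,\dots,x_{j-1})N$. It is *of type* $(k_1,\dots,k_r)$ if there are indices $c(1),\dots,c(t)$ with $x_j\in I_{c(j)}$ for all $j$ and exactly $k_i$ of the $j$ satisfying $c(j)=i$, for each $i$. A set $\mathfrak R$ consisting of $k_i$ elements of $I_i$ $(i=1,\dots,r)$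 is a *joint reduction* of $\mathcal I$ with respect to $N$ of type $(k_1,\dots,k_r)$ if $$I_1^{n_1+1}\cdots I_r^{n_r+1}N=\sum_{i=1}^r(\mathfrak R\cap I_i)\,I_1^{n_1+1}\cdots I_i^{n_i}\cdots I_r^{n_r+1}N$$ for all large $n_1,\dots,n_r$. *Statement.* Set $I=I_1\cdots I_s$ and assume $$\mathrm{ht}\Big(\frac{I+\mathrm{Ann}_AM}{\mathrm{Ann}_AM}\Big)=h>0$$ (the unit ideal having height $\infty$). Let $k_0,k_1,\dots,k_s$ be non-negative integers with $k_0+k_1+\cdots+k_s=d-1$ and $k_1+\cdots+k_s<h$, and assume $I_i\neq A$ whenever $k_i>0$. Then: 1. There exists a Rees superficial sequence $x_1,\dots,x_d$ of $(I_1,\dots,I_s,J)$ with respect to $M$ of type $(k_1,\dots,k_s,k_0+1)$ that is a system of parameters for $M$; moreover the indices $c(j)$ can be chosen so that each $x_j$ is Rees superficial for the index $c(j)$ with respect to $M/(x_1,\dots,x_{j-1})M$. 2. If $x_1,\dots,x_d$ is any Rees superficial sequence of $(I_1,\dots,I_s,J)$ with respect to $M$ of type $(k_1,\dots,k_s,k_0+1)$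 that is a system of parameters for $M$, then $\{x_1,\dots,x_d\}$ is a joint reduction of $(I_1,\dots,I_s,J)$ with respect to $M$ of type $(k_1,\dots,k_s,k_0+1)$. -/

import Mathlib

namespace JointRed

section

variable {A : Type*} [CommRing A] {ι : Type*} [Fintype ι] [DecidableEq ι]

/-- The element `x ∈ I i` satisfies, for the index `i`,
`x M ∩ I₁^{n₁} ⋯ Iᵢ^{nᵢ+1} ⋯ Iₛ^{nₛ} M = x I₁^{n₁} ⋯ Iᵢ^{nᵢ} ⋯ Iₛ^{nₛ} M`
for all `nᵢ ≫ 0` and all other `n_l ≥ 0`. -/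
def IsReesSuperficialAt (I : ι → Ideal A) (M : Type*) [AddCommGroup M] [Module A M]
    (i : ι) (x : A) : Prop :=
  x ∈ I i ∧ ∃ N : ℕ, ∀ n : ι → ℕ, N ≤ n i →
    (Ideal.span {x} • (⊤ : Submodule A M)) ⊓
        ((∏ l, I l ^ Function.update n i (n i + 1) l) • (⊤ : Submodule A M)) =
      Ideal.span {x} • ((∏ l, I l ^ n l) • (⊤ : Submodule A M))

/-- `x` is a Rees superficial element of the family `I` with respect to `M`. -/
def IsReesSuperficial (I : ι → Ideal A) (M : Type*) [AddCommGroup M] [Module A M]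
    (x : A) : Prop :=
  ∃ i, IsReesSuperficialAt I M i x

/-- The submodule `(x₁, …, x_j) M`: for the zero-based index `j`, it is generated by the terms of
`x` strictly preceding the term `x j`. -/
def precSubmodule {t : ℕ} (x : Fin t → A) (M : Type*) [AddCommGroup M] [Module A M]
    (j : Fin t) : Submodule A M :=
  Ideal.span (x '' {l | l < j}) • (⊤ : Submodule A M)

/-- `x` is a Rees superficial sequence of the family `I` with respect to `M`. -/
def IsReesSuperficialSeq (I : ι → Ideal A) (M : Type*) [AddCommGroup M] [Module A M]
    {t : ℕ} (x : Fin t → A) : Prop :=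
  ∀ j, IsReesSuperficial I (M ⧸ precSubmodule x M j) (x j)

/-- The Rees superficial sequence `x` whose `j`-th term is superficial for the index `c j`. -/
def IsReesSuperficialSeqAlong (I : ι → Ideal A) (M : Type*) [AddCommGroup M] [Module A M]
    {t : ℕ} (c : Fin t → ι) (x : Fin t → A) : Prop :=
  ∀ j, IsReesSuperficialAt I (M ⧸ precSubmodule x M j) (c j) (x j)

/-- `c` distributes the terms of `x` among the ideals, with exactly `k i` terms, all of them
lying in `I i`, going to the index `i`. -/
def IsDistribution (I : ι → Ideal A) (k : ι → ℕ) {t : ℕ} (x : Fin t → A) (c : Fin t → ι) : Prop :=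
  (∀ j, x j ∈ I (c j)) ∧ ∀ i, (Finset.univ.filter fun j => c j = i).card = k i

/-- `x` consists of `k i` elements of `I i`, for every `i`. -/
def HasType (I : ι → Ideal A) (k : ι → ℕ) {t : ℕ} (x : Fin t → A) : Prop :=
  ∃ c, IsDistribution I k x c

/-- The set `R` is a joint reduction of the family `I` with respect to `M` of type `k`. -/
def IsJointReduction (I : ι → Ideal A) (M : Type*) [AddCommGroup M] [Module A M]
    (k : ι → ℕ) (R : Set A) : Prop :=
  (∃ c : A → ι, (∀ x ∈ R, x ∈ I (c x)) ∧ ∀ i, {x ∈ R | c x = i}.encard = k i) ∧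
  ∃ N : ℕ, ∀ n : ι → ℕ, (∀ i, N ≤ n i) →
    (∏ l, I l ^ (n l + 1)) • (⊤ : Submodule A M) =
      ⨆ i, Ideal.span (R ∩ (I i : Set A)) •
        ((∏ l, I l ^ Function.update (fun l => n l + 1) i (n i) l) • (⊤ : Submodule A M))

/-- `x₁, …, x_d` is a system of parameters for `M`: `d = dim M`, the `x_j` lie in the maximal
ideal, and `M / (x₁, …, x_d) M` has finite length. -/
def IsSystemOfParameters [IsLocalRing A] (M : Type*) [AddCommGroup M] [Module A M]
    {d : ℕ} (x : Fin d → A) : Prop :=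
  Module.supportDim A M = d ∧ (∀ j, x j ∈ IsLocalRing.maximalIdeal A) ∧
    IsFiniteLength A (M ⧸ (Ideal.span (Set.range x) • (⊤ : Submodule A M)))

end

end JointRed

/-!
Both parts rest on one observation about a Rees superficial sequence `x₁, …, x_d`: an element of
`(x₁, …, x_d) M` that lies in `(∏ Iₗ ^ nₗ) M`, all `nₗ` large, can be written as `∑ xⱼ yⱼ` with each
`yⱼ` of the expected order. This follows by applying the defining equality in
`M / (x₁, …, x_{j-1}) M` for decreasing `j` (`exists_forall_inf_le_iSup`). If the `xⱼ` form a system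
of parameters, then `M / (x₁, …, x_d) M` is killed by a power of `J`, so for large `n` every element
of `(∏ Iₗ ^ nₗ) M` is of this kind, which is the joint reduction property
(`isJointReduction_of_isReesSuperficialSeq`). A system of parameters has no repeated terms, because
`dim M` generators at least are needed to cut `M` down to finite length; so the type of the sequence
is the type of the set of its terms.

Existence needs Rees's lemma (`exists_isReesSuperficialAt`): `I i` has a superficial element outside
any finite set of primes not containing `I i`. It is proved on the extended multi-Rees module
`F = ⨁ (∏ Iₗ ^ nₗ) N tⁿ`, `n` an integer vector, inside `V = ⨁ N tⁿ`. Both are modules over a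
polynomial ring with one variable `t_l⁻¹` for each ideal and one variable `a t_l` for each generator
`a` of the ideal `I l`; `F` is finitely generated. Let `U` be the product of the variables `t_l⁻¹`.
A generic `x ∈ I i` is such that `x tᵢ` avoids the associated primes of `F / U F` not containing
`I i tᵢ`, and then a power of `I i tᵢ` sends every `w ∈ U⁻ᶜ F` with `x tᵢ w ∈ F` into `F`. The module
of these `w` is finitely generated, so it agrees with `F` in degrees large in the direction `i`,
whatever the other coordinates. The Artin–Rees lemma for `x V ∩ F` shows that an element of
`x N ∩ (∏ Iₗ ^ nₗ) N` is `x` times a component of such a `w`.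

For the parameters, suppose that `dim M / (x₁, …, x_{j-1}) M ≤ d - (j-1)`. A generic `xⱼ ∈ I i` lowers
this bound unless a chain of `d - (j-1)` steps in the support starts at a prime `P ⊇ I i`. For the
first `k₁ + ⋯ + k_s < h` indices this is impossible, as the height of `P` modulo the annihilator
would be at least `h ≥ j`; afterwards `I i` is `J`, and `P` is the maximal ideal.
-/

namespace JointRed

set_option linter.unusedSectionVars false

/-! ### Generic choices over an infinite residue field -/

/-- A finitely generated module over a Noetherian ring, an element `X` and an ideal `𝔱` contained
in every associated prime that contains `X`: a power of `𝔱` kills the elements killed by `X`. -/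
theorem exists_pow_smul_eq_zero_of_associatedPrimes {S : Type*} [CommRing S] [IsNoetherianRing S]
    {K : Type*} [AddCommGroup K] [Module S K] [Module.Finite S K] (X : S) (𝔱 : Ideal S)
    (h : ∀ Q ∈ associatedPrimes S K, X ∈ Q → 𝔱 ≤ Q) :
    ∃ p : ℕ, ∀ g ∈ 𝔱 ^ p, ∀ y : K, X • y = 0 → g • y = 0 := by
  have hrad : 𝔱 ≤ (Module.annihilator S (Submodule.torsionBy S K X)).radical := by
    rw [← Ideal.sInf_minimalPrimes]
    refine le_sInf fun Q hQ => ?_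
    have hQ' := Module.associatedPrimes.minimalPrimes_annihilator_subset_associatedPrimes S
      (Submodule.torsionBy S K X) hQ
    refine h Q (associatedPrimes.subset_of_injective
      (f := (Submodule.torsionBy S K X).subtype) (Submodule.injective_subtype _) hQ') ?_
    refine hQ.1.2 (Module.mem_annihilator.2 fun y => ?_)
    exact Subtype.ext ((Submodule.mem_torsionBy_iff _ _).1 y.2)
  obtain ⟨p, hp⟩ := Ideal.exists_pow_le_of_le_radical_of_fg hrad (IsNoetherian.noetherian _)
  refine ⟨p, fun g hg y hy => ?_⟩
  have := Module.mem_annihilator.1 (hp hg) ⟨y, (Submodule.mem_torsionBy_iff _ _).2 hy⟩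
  exact congrArg Subtype.val this

/-- Over a local ring with infinite residue field, a finite free module is not the union of
finitely many proper submodules. -/
theorem exists_forall_notMem_of_finite {A : Type*} [CommRing A] [IsLocalRing A]
    [Infinite (IsLocalRing.ResidueField A)] {κ : Type*} [Finite κ]
    {s : Set (Submodule A (κ → A))} (hs : s.Finite) (htop : ⊤ ∉ s) :
    ∃ v : κ → A, ∀ W ∈ s, v ∉ W := by
  classical
  have : RingHomSurjective (IsLocalRing.residue A) := ⟨IsLocalRing.residue_surjective⟩
  let π : (κ → A) →ₛₗ[IsLocalRing.residue A] (κ → IsLocalRing.ResidueField A) :=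
    { toFun := fun v j => IsLocalRing.residue A (v j)
      map_add' := fun v w => by ext j; simp
      map_smul' := fun r v => by ext j; simp }
  have hker : ∀ v, π v = 0 → v ∈ IsLocalRing.maximalIdeal A • (⊤ : Submodule A (κ → A)) := by
    intro v hv
    have := Fintype.ofFinite κ
    rw [pi_eq_sum_univ v]
    refine Submodule.sum_mem _ fun j _ => Submodule.smul_mem_smul ?_ trivial
    exact (IsLocalRing.residue_eq_zero_iff _).1 (congrFun hv j)
  let t := (hs.image (Submodule.map π)).toFinset
  have ht : (⊤ : Submodule (IsLocalRing.ResidueField A) _) ∉ t := by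
    intro h
    obtain ⟨W, hW, hWt⟩ := (Set.Finite.mem_toFinset _).1 h
    suffices W = ⊤ from htop (this ▸ hW)
    refine top_le_iff.1 (Submodule.le_of_le_smul_of_le_jacobson_bot (I := IsLocalRing.maximalIdeal A)
      (Module.Finite.fg_top) (IsLocalRing.maximalIdeal_le_jacobson _) fun v _ => ?_)
    have : π v ∈ Submodule.map π W := hWt ▸ Submodule.mem_top
    obtain ⟨w, hw, hwv⟩ := this
    rw [← add_sub_cancel w v]
    exact Submodule.add_mem_sup hw (hker _ (by rw [map_sub, hwv, sub_self]))
  have := Subspace.biUnion_ne_univ_of_top_notMem ht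
  obtain ⟨w, hw⟩ := (Set.ne_univ_iff_exists_notMem _).1 this
  choose v hv using fun j => IsLocalRing.residue_surjective (R := A) (w j)
  refine ⟨v, fun W hW hvW => hw ?_⟩
  have e : π v = w := funext hv
  refine Set.mem_biUnion (x := Submodule.map π W) ?_ (e ▸ Submodule.mem_map_of_mem hvW)
  exact (Set.Finite.mem_toFinset _).2 ⟨W, hW, rfl⟩

/-! ### The multigraded Laurent module -/

section Laurent

variable {A : Type*} [CommRing A] {σ G : Type*} [AddCommGroup G]

/-- The module `N[G]` of finitely supported functions `G → N`, written `⨁ N tⁿ` with `n : G`, on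
which the variable `X j` of the polynomial ring over `A` acts as multiplication by
`a j • t ^ (δ j)`. The data `a` and `δ` are part of the type so that the action can be found. -/
def LaurentModule (_a : σ → A) (_δ : σ → G) (N : Type*) [AddCommGroup N] : Type _ := G →₀ N

namespace LaurentModule

variable (a : σ → A) (δ : σ → G) (N : Type*) [AddCommGroup N] [Module A N]

noncomputable instance : AddCommGroup (LaurentModule a δ N) :=
  inferInstanceAs (AddCommGroup (G →₀ N))
noncomputable instance : Module A (LaurentModule a δ N) := inferInstanceAs (Module A (G →₀ N))

/-- The action of the monomials on `N[G]`. -/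
noncomputable def monomialAction :
    Multiplicative (σ →₀ ℕ) →* Module.End A (G →₀ N) where
  toFun m := (m.toAdd.prod fun j e => a j ^ e) •
    Finsupp.lmapDomain N A (· + m.toAdd.sum fun j e => e • δ j)
  map_one' := by
    ext n y
    simp
  map_mul' m m' := by
    classical
    ext n y : 2
    have h1 : (m * m').toAdd.prod (fun j e => a j ^ e) =
        m.toAdd.prod (fun j e => a j ^ e) * m'.toAdd.prod (fun j e => a j ^ e) :=
      Finsupp.prod_add_index' (by simp) (by intros; exact pow_add _ _ _)
    have h2 : (m * m').toAdd.sum (fun j e => e • δ j) =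
        m.toAdd.sum (fun j e => e • δ j) + m'.toAdd.sum (fun j e => e • δ j) :=
      Finsupp.sum_add_index' (by simp) (by intros; exact add_smul _ _ _)
    simp only [h1, h2, LinearMap.comp_apply, LinearMap.smul_apply, Finsupp.lmapDomain_apply,
      Finsupp.lsingle_apply, Finsupp.mapDomain_single, Module.End.mul_apply, Finsupp.smul_single,
      smul_smul]
    congr 1
    abel

noncomputable instance : Module (MvPolynomial σ A) (LaurentModule a δ N) :=
  Module.compHom (G →₀ N)
    (AddMonoidAlgebra.lift A (Module.End A (G →₀ N)) (σ →₀ ℕ)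
      (monomialAction a δ N)).toRingHom

variable {a δ N}

instance : CoeFun (LaurentModule a δ N) fun _ => G → N := ⟨fun f => Finsupp.toFun f⟩

@[ext] theorem ext {f g : LaurentModule a δ N} (h : ∀ n, f n = g n) : f = g := Finsupp.ext h

@[simp] theorem smul_apply (r : A) (f : LaurentModule a δ N) (n : G) : (r • f) n = r • f n := rfl

theorem monomial_smul_apply (m : σ →₀ ℕ) (r : A) (f : LaurentModule a δ N) (n : G) :
    (MvPolynomial.monomial m r • f) n =
      (r * m.prod fun j e => a j ^ e) • f (n - m.sum fun j e => e • δ j) := by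
  let f' : G →₀ N := f
  have h : (AddMonoidAlgebra.lift A (Module.End A (G →₀ N)) (σ →₀ ℕ)
      (monomialAction a δ N)) (AddMonoidAlgebra.single m r) f' =
      r • (m.prod fun j e => a j ^ e) •
        Finsupp.mapDomain (· + m.sum fun j e => e • δ j) f' := by
    rw [AddMonoidAlgebra.lift_single]
    rfl
  have h' := Finsupp.mapDomain_apply (add_left_injective (m.sum fun j e => e • δ j)) f'
    (n - m.sum fun j e => e • δ j)
  refine (DFunLike.congr_fun h n).trans ?_
  rw [sub_add_cancel] at h'
  rw [Finsupp.smul_apply, Finsupp.smul_apply, h', mul_smul]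
  rfl

@[simp] theorem X_smul_apply (j : σ) (f : LaurentModule a δ N) (n : G) :
    ((MvPolynomial.X j : MvPolynomial σ A) • f) n = a j • f (n - δ j) := by
  simp [MvPolynomial.X, monomial_smul_apply]

theorem C_smul (r : A) (f : LaurentModule a δ N) :
    (MvPolynomial.C r : MvPolynomial σ A) • f = r • f := by
  ext n
  rw [MvPolynomial.C_apply, monomial_smul_apply]
  simp

/-- An `A`-submodule of `N[G]` that is stable under the variables is a submodule over the
polynomial ring. -/
def ofStable (W : Submodule A (LaurentModule a δ N))
    (h : ∀ j, ∀ f ∈ W, (MvPolynomial.X j : MvPolynomial σ A) • f ∈ W) :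
    Submodule (MvPolynomial σ A) (LaurentModule a δ N) :=
  { W.toAddSubmonoid with
    smul_mem' := fun p f hf => by
      induction p using MvPolynomial.induction_on generalizing f with
      | C r => rw [C_smul]; exact W.smul_mem r hf
      | add p q hp hq => rw [add_smul]; exact W.add_mem (hp f hf) (hq f hf)
      | mul_X p j hp => rw [mul_smul]; exact hp _ (h j f hf) }

/-- A homogeneous element `y tⁿ` of `N[G]`. -/
noncomputable def single (n : G) : N →ₗ[A] LaurentModule a δ N := Finsupp.lsingle n

theorem single_apply [DecidableEq G] (n m : G) (y : N) :
    (single n y : LaurentModule a δ N) m = if n = m then y else 0 := Finsupp.single_apply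

@[simp] theorem single_apply_self (n : G) (y : N) : (single n y : LaurentModule a δ N) n = y :=
  Finsupp.single_eq_same

theorem X_smul_single (j : σ) (n : G) (y : N) :
    (MvPolynomial.X j : MvPolynomial σ A) • (single n y : LaurentModule a δ N) =
      single (n + δ j) (a j • y) := by
  classical
  ext m
  rw [X_smul_apply, single_apply, single_apply]
  simp [eq_sub_iff_add_eq]

end LaurentModule

end Laurent

/-! ### The extended multi-Rees module -/

section Rees

variable {A : Type*} [CommRing A] {ι : Type*} [Fintype ι] [DecidableEq ι]

/-- The filtration `n ↦ (∏ l, I l ^ n l) N` indexed by integer vectors, a negative exponent being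
read as `0`. -/
def idealFiltration (I : ι → Ideal A) (N : Type*) [AddCommGroup N] [Module A N] (n : ι → ℤ) :
    Submodule A N :=
  (∏ l, I l ^ (n l).toNat) • ⊤

section

variable (I : ι → Ideal A) (N : Type*) [AddCommGroup N] [Module A N]

theorem idealFiltration_antitone : Antitone (idealFiltration I N) := fun _ _ h =>
  Submodule.smul_mono_left <| Finset.prod_le_prod' fun l _ =>
    Ideal.pow_le_pow_right (Int.toNat_le_toNat (h l))

theorem idealFiltration_of_nonpos {n : ι → ℤ} (h : n ≤ 0) : idealFiltration I N n = ⊤ := by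
  have : ∏ l, I l ^ (n l).toNat = ⊤ := by
    rw [← Ideal.one_eq_top]
    refine Finset.prod_eq_one fun l _ => ?_
    rw [Int.toNat_of_nonpos (h l), pow_zero]
  rw [idealFiltration, this, Submodule.top_smul]

variable {I N}

theorem smul_mem_idealFiltration {l : ι} {a : A} (ha : a ∈ I l) {n : ι → ℤ} {y : N}
    (hy : y ∈ idealFiltration I N n) : a • y ∈ idealFiltration I N (n + Pi.single l 1) := by
  have hle : I l * ∏ k, I k ^ (n k).toNat ≤ ∏ k, I k ^ ((n + (Pi.single l 1 : ι → ℤ)) k).toNat := by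
    rw [← Finset.mul_prod_erase _ _ (Finset.mem_univ l),
      ← Finset.mul_prod_erase _ 
        (fun k => I k ^ ((n + (Pi.single l 1 : ι → ℤ)) k).toNat) (Finset.mem_univ l),
      ← mul_assoc, ← pow_succ']
    refine Ideal.mul_mono (Ideal.pow_le_pow_right ?_) (Finset.prod_le_prod' fun k hk => ?_)
    · simp only [Pi.add_apply, Pi.single_eq_same]
      omega
    · simp [Pi.single_eq_of_ne (Finset.ne_of_mem_erase hk)]
  refine Submodule.smul_mono_left hle ?_
  rw [Submodule.mul_smul]
  exact Submodule.smul_mem_smul ha hy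

end

variable {κ : ι → Type*} (g : ∀ l, κ l → A)

/-- The coefficients of the variables acting on the extended Rees module: `1` for the inverse
variables and the chosen generators `g l j` of the ideals for the others. -/
def reesCoeff : ι ⊕ (Σ l, κ l) → A := Sum.elim (fun _ => 1) fun j => g j.1 j.2

/-- The degrees of the variables acting on the extended Rees module: `-1` in the direction `l` for
the `l`-th inverse variable, `+1` in the direction `l` for the generators of the `l`-th ideal. -/
def reesShift (κ : ι → Type*) : ι ⊕ (Σ l, κ l) → ι → ℤ :=
  Sum.elim (fun l => -Pi.single l 1) fun j => Pi.single j.1 1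

variable (N : Type*) [AddCommGroup N] [Module A N]

/-- The module `⨁ N tⁿ`, `n` an integer vector, over the polynomial ring that maps onto the
extended multi-Rees algebra of the ideals generated by the families `g l`. -/
abbrev ReesAmbient : Type _ := LaurentModule (reesCoeff g) (reesShift κ) N

/-- The ideal generated by the family `g l`. -/
abbrev genIdeal (l : ι) : Ideal A := Ideal.span (Set.range (g l))

/-- The polynomial ring that maps onto the extended multi-Rees algebra. -/
abbrev ReesPoly (A : Type*) [CommRing A] {ι : Type*} (κ : ι → Type*) : Type _ :=
  MvPolynomial (ι ⊕ (Σ l, κ l)) A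

/-- The extended multi-Rees module `⨁ (∏ l, I l ^ n l) N tⁿ` inside `⨁ N tⁿ`. -/
noncomputable def reesModule : Submodule (ReesPoly A κ) (ReesAmbient g N) :=
  LaurentModule.ofStable
    { carrier := {f | ∀ n, f n ∈ idealFiltration (genIdeal g) N n}
      add_mem' := fun hf hf' n => add_mem (hf n) (hf' n)
      zero_mem' := fun n => zero_mem _
      smul_mem' := fun r f hf n => Submodule.smul_mem _ r (hf n) }
    (by
      rintro (l | ⟨l, j⟩) f hf n
      · rw [LaurentModule.X_smul_apply]
        simp only [reesCoeff, reesShift, Sum.elim_inl, one_smul, sub_neg_eq_add]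
        refine idealFiltration_antitone _ _ ?_ (hf _)
        simp [Pi.le_def, Pi.single_apply]
        intro k; split_ifs <;> simp
      · rw [LaurentModule.X_smul_apply]
        simp only [reesCoeff, reesShift, Sum.elim_inr]
        have := smul_mem_idealFiltration (I := genIdeal g) (l := l)
          (Ideal.subset_span (Set.mem_range_self j)) (hf (n - Pi.single l 1))
        rwa [sub_add_cancel] at this)

variable {N} {g}

theorem mem_reesModule {f : ReesAmbient g N} :
    f ∈ reesModule g N ↔ ∀ n, f n ∈ idealFiltration (genIdeal g) N n := Iff.rfl

theorem single_mem_reesModule {n : ι → ℤ} {y : N} :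
    (LaurentModule.single n y : ReesAmbient g N) ∈ reesModule g N ↔
      y ∈ idealFiltration (genIdeal g) N n := by
  refine ⟨fun h => by simpa using h n, fun h m => ?_⟩
  rw [LaurentModule.single_apply]
  split_ifs with e
  · exact e ▸ h
  · exact zero_mem _

/-- The submodule of `N[G]` spanned by the component of degree `0` contains the extended Rees
module. -/
theorem reesModule_le_span :
    reesModule g N ≤ Submodule.span (ReesPoly A κ)
      (Set.range (LaurentModule.single (0 : ι → ℤ) : N → ReesAmbient g N)) := by
  set P := Submodule.span (ReesPoly A κ)
      (Set.range (LaurentModule.single (0 : ι → ℤ) : N → ReesAmbient g N))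
  -- `W n` is the component of degree `n` of the span
  let W : (ι → ℤ) → Submodule A N := fun n =>
    { carrier := {y | LaurentModule.single n y ∈ P}
      add_mem' := fun h h' => by
        simp only [Set.mem_ofPred_eq, map_add]
        exact add_mem h h'
      zero_mem' := by simp
      smul_mem' := fun r y h => by
        simp only [Set.mem_ofPred_eq, map_smul]
        rw [← LaurentModule.C_smul]
        exact P.smul_mem _ h }
  have h0 : W 0 = ⊤ := top_le_iff.1 fun y _ => Submodule.subset_span ⟨y, rfl⟩
  have hup : ∀ l n, genIdeal g l • W n ≤ W (n + Pi.single l 1) := by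
    intro l n
    rw [Submodule.smul_le]
    intro r hr y hy
    suffices h : genIdeal g l ≤ (W (n + Pi.single l 1)).colon {y} by
      exact Submodule.mem_colon_singleton.1 (h hr)
    rw [Ideal.span_le]
    rintro _ ⟨j, rfl⟩
    refine Submodule.mem_colon_singleton.2 ?_
    have := P.smul_mem (MvPolynomial.X (Sum.inr ⟨l, j⟩) : ReesPoly A κ) hy
    rwa [LaurentModule.X_smul_single] at this
  have hdown : ∀ l n, W n ≤ W (n - Pi.single l 1) := by
    intro l n y hy
    have := P.smul_mem (MvPolynomial.X (Sum.inl l) : ReesPoly A κ) hy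
    rw [LaurentModule.X_smul_single] at this
    simp only [reesCoeff, reesShift, Sum.elim_inl, one_smul, ← sub_eq_add_neg] at this
    exact this
  have hup' : ∀ (l : ι) (k : ℕ) n, genIdeal g l ^ k • W n ≤ W (n + Pi.single l (k : ℤ)) := by
    intro l k
    induction k with
    | zero => intro n; simp
    | succ k ih =>
      intro n
      rw [pow_succ', Submodule.mul_smul]
      refine (Submodule.smul_mono le_rfl (ih n)).trans ((hup l _).trans (le_of_eq ?_))
      rw [add_assoc, ← Pi.single_add]
      simp
  have hdown' : ∀ (l : ι) (k : ℕ) n, W n ≤ W (n - Pi.single l (k : ℤ)) := by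
    intro l k
    induction k with
    | zero => intro n; simp
    | succ k ih =>
      intro n
      refine (ih n).trans ((hdown l _).trans (le_of_eq ?_))
      rw [sub_sub, ← Pi.single_add]
      simp
  have hone : ∀ (l : ι) (k : ℤ) n,
      genIdeal g l ^ k.toNat • W n ≤ W (n + Pi.single l k) := by
    intro l k n
    rcases le_total 0 k with hk | hk
    · have := hup' l k.toNat n
      rwa [Int.toNat_of_nonneg hk] at this
    · have := hdown' l (-k).toNat n
      rw [Int.toNat_of_nonneg (by omega)] at this
      rw [Int.toNat_of_nonpos hk, pow_zero, Ideal.one_eq_top, Submodule.top_smul]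
      simpa [Pi.single_neg] using this
  have hprod : ∀ (n : ι → ℤ) (T : Finset ι),
      (∏ l ∈ T, genIdeal g l ^ (n l).toNat) • (⊤ : Submodule A N) ≤
        W (∑ l ∈ T, Pi.single l (n l)) := by
    intro n T
    induction T using Finset.induction_on with
    | empty => simp [h0]
    | insert l T hl ih =>
      rw [Finset.prod_insert hl, Finset.sum_insert hl, Submodule.mul_smul, add_comm]
      exact (Submodule.smul_mono le_rfl ih).trans (hone _ _ _)
  intro f hf
  have hfs : f = ∑ n ∈ Finsupp.support f, (LaurentModule.single n (f n) : ReesAmbient g N) :=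
    (Finsupp.sum_single (show (ι → ℤ) →₀ N from f)).symm
  rw [hfs]
  refine sum_mem fun n _ => ?_
  have := hprod n Finset.univ (hf n)
  rwa [Finset.univ_sum_single] at this

theorem reesModule_eq_span :
    reesModule g N = Submodule.span (ReesPoly A κ)
      (Set.range (LaurentModule.single (0 : ι → ℤ) : N → ReesAmbient g N)) := by
  refine le_antisymm reesModule_le_span (Submodule.span_le.2 ?_)
  rintro _ ⟨y, rfl⟩
  exact single_mem_reesModule.2 (by rw [idealFiltration_of_nonpos _ _ le_rfl]; trivial)

theorem reesModule_fg [Module.Finite A N] : (reesModule g N).FG := by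
  obtain ⟨s, hs⟩ := Module.Finite.fg_top (R := A) (M := N)
  classical
  refine ⟨s.image (LaurentModule.single 0), ?_⟩
  rw [reesModule_eq_span]
  refine le_antisymm (Submodule.span_mono ?_) (Submodule.span_le.2 ?_)
  · simp only [Finset.coe_image]
    exact Set.image_subset_range _ _
  · rintro _ ⟨y, rfl⟩
    have hy : y ∈ Submodule.span A (s : Set N) := hs ▸ Submodule.mem_top
    simp only [Finset.coe_image]
    induction hy using Submodule.span_induction with
    | mem y hy => exact Submodule.subset_span ⟨y, hy, rfl⟩
    | zero => simp
    | add x y _ _ hx hy => rw [map_add]; exact add_mem hx hy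
    | smul r y _ hy =>
      rw [map_smul, ← LaurentModule.C_smul]
      exact Submodule.smul_mem _ _ hy

variable (A κ) in
/-- The product of the inverse variables. -/
noncomputable def invProd : ReesPoly A κ := ∏ l, MvPolynomial.X (Sum.inl l)

theorem invProd_smul_apply (f : ReesAmbient g N) (n : ι → ℤ) :
    (invProd A κ • f) n = f (n + 1) := by
  have : ∀ (T : Finset ι) (f : ReesAmbient g N) (n : ι → ℤ),
      ((∏ l ∈ T, MvPolynomial.X (Sum.inl l) : ReesPoly A κ) • f) n =
        f (n + ∑ l ∈ T, Pi.single l 1) := by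
    intro T
    induction T using Finset.induction_on with
    | empty => intro f n; simp
    | insert l T hl ih =>
      intro f n
      rw [Finset.prod_insert hl, mul_smul, LaurentModule.X_smul_apply, ih, Finset.sum_insert hl]
      simp [reesCoeff, reesShift, add_assoc]
  rw [invProd, this]
  congr 2
  exact Finset.univ_sum_single (1 : ι → ℤ)

theorem invProd_pow_smul_apply (c : ℕ) (f : ReesAmbient g N) (n : ι → ℤ) :
    (invProd A κ ^ c • f) n = f (n + fun _ => (c : ℤ)) := by
  induction c generalizing n with
  | zero =>
    rw [pow_zero, one_smul]
    congr 1
    ext; simp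
  | succ c ih =>
    rw [pow_succ', mul_smul, invProd_smul_apply, ih]
    congr 1
    ext; simp; ring

theorem invProd_pow_smul_mem_reesModule {c : ℕ} {f : ReesAmbient g N} :
    invProd A κ ^ c • f ∈ reesModule g N ↔
      ∀ n, f n ∈ idealFiltration (genIdeal g) N (n - fun _ => (c : ℤ)) := by
  simp only [mem_reesModule, invProd_pow_smul_apply]
  refine ⟨fun h n => ?_, fun h n => ?_⟩
  · have := h (n - fun _ => (c : ℤ))
    rwa [sub_add_cancel] at this
  · have := h (n + fun _ => (c : ℤ))
    rwa [add_sub_cancel_right] at this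

theorem invProd_pow_smul_injective (c : ℕ) :
    Function.Injective (fun f : ReesAmbient g N => invProd A κ ^ c • f) := by
  intro f f' h
  ext n
  have := congrArg (fun f : ReesAmbient g N => f (n - fun _ => (c : ℤ))) h
  simpa [invProd_pow_smul_apply] using this

end Rees

/-! ### Existence of Rees superficial elements -/

section Superficial

variable {A : Type*} [CommRing A] {ι : Type*} [Fintype ι] [DecidableEq ι]
  {κ : ι → Type*} {g : ∀ l, κ l → A} {N : Type*} [AddCommGroup N] [Module A N]

theorem exists_invProd_pow_smul_mem (f : ReesAmbient g N) :
    ∃ c : ℕ, invProd A κ ^ c • f ∈ reesModule g N := by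
  refine ⟨∑ n ∈ Finsupp.support f, ∑ l, (n l).toNat, ?_⟩
  rw [invProd_pow_smul_mem_reesModule]
  intro n
  by_cases hn : f n = 0
  · rw [hn]
    exact zero_mem _
  · rw [idealFiltration_of_nonpos]
    · trivial
    · intro l
      have h1 : (n l).toNat ≤ ∑ l, (n l).toNat :=
        Finset.single_le_sum (f := fun l => (n l).toNat) (fun _ _ => Nat.zero_le _)
          (Finset.mem_univ l)
      have h2 : ∑ l, (n l).toNat ≤ ∑ n ∈ Finsupp.support f, ∑ l, (n l).toNat :=
        Finset.single_le_sum (f := fun n : ι → ℤ => ∑ l, (n l).toNat) (fun _ _ => Nat.zero_le _)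
          (Finsupp.mem_support_iff.2 hn)
      simp only [Pi.sub_apply, Pi.zero_apply]
      omega

theorem invProd_pow_smul_mem_mono {c c' : ℕ} (h : c ≤ c') {f : ReesAmbient g N}
    (hf : invProd A κ ^ c • f ∈ reesModule g N) : invProd A κ ^ c' • f ∈ reesModule g N := by
  obtain ⟨k, rfl⟩ := Nat.exists_eq_add_of_le' h
  rw [pow_add, mul_smul]
  exact Submodule.smul_mem _ _ hf

/-- An Artin–Rees statement: an element of the extended Rees module that is divisible by `x` in
`⨁ N tⁿ` is divisible by `x` up to a bounded loss in degree. -/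
theorem exists_smul_eq_of_smul_mem_reesModule [IsNoetherianRing A] [∀ l, Finite (κ l)]
    [Module.Finite A N] (x : A) :
    ∃ c : ℕ, ∀ f : ReesAmbient g N, x • f ∈ reesModule g N →
      ∃ f' : ReesAmbient g N, x • f' = x • f ∧ invProd A κ ^ c • f' ∈ reesModule g N := by
  let R := LinearMap.range (LinearMap.lsmul (ReesPoly A κ) (ReesAmbient g N) (MvPolynomial.C x))
  have : IsNoetherian (ReesPoly A κ) (reesModule g N) :=
    isNoetherian_of_fg_of_noetherian _ reesModule_fg
  obtain ⟨s, hs⟩ := isNoetherian_submodule.1 this (reesModule g N ⊓ R) inf_le_left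
  have hs' : ∀ y ∈ s, ∃ c : ℕ, ∃ f' : ReesAmbient g N, x • f' = y ∧
      invProd A κ ^ c • f' ∈ reesModule g N := by
    intro y hy
    obtain ⟨f', hf'⟩ : y ∈ R := (hs ▸ Submodule.subset_span hy : y ∈ reesModule g N ⊓ R).2
    obtain ⟨c, hc⟩ := exists_invProd_pow_smul_mem f'
    exact ⟨c, f', by rw [← LaurentModule.C_smul]; exact hf', hc⟩
  choose! c hc using hs'
  refine ⟨s.sup c, fun f hf => ?_⟩
  suffices h : reesModule g N ⊓ R ≤ Submodule.map
      (LinearMap.lsmul (ReesPoly A κ) (ReesAmbient g N) (MvPolynomial.C x))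
      (Submodule.comap (LinearMap.lsmul (ReesPoly A κ) (ReesAmbient g N) (invProd A κ ^ s.sup c))
        (reesModule g N)) by
    obtain ⟨f', h1, h2⟩ := h ⟨hf, f, by simp [LaurentModule.C_smul]⟩
    exact ⟨f', by rw [← h2]; simp [LaurentModule.C_smul], h1⟩
  rw [← hs, Submodule.span_le]
  intro y hy
  obtain ⟨f', h1, h2⟩ := hc y hy
  refine ⟨f', invProd_pow_smul_mem_mono (Finset.le_sup hy) h2, ?_⟩
  rw [← h1]
  simp [LaurentModule.C_smul]

/-- The ideal generated by the variables that lie over the generators of the `i`-th ideal. -/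
noncomputable def positiveIdeal (A : Type*) [CommRing A] (κ : ι → Type*) (i : ι) :
    Ideal (ReesPoly A κ) :=
  Ideal.span (Set.range fun j : κ i => MvPolynomial.X (Sum.inr ⟨i, j⟩))

theorem monomial_mem_positiveIdeal_pow (i : ι) (m : (ι ⊕ (Σ l, κ l)) →₀ ℕ) (r : A) :
    (MvPolynomial.monomial m r : ReesPoly A κ) ∈
      positiveIdeal A κ i ^ ((m.sum fun j e => e • reesShift κ j) i).toNat := by
  suffices h : (MvPolynomial.monomial m 1 : ReesPoly A κ) ∈
      positiveIdeal A κ i ^ ((m.sum fun j e => e • reesShift κ j) i).toNat by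
    have := Ideal.mul_mem_left _ (MvPolynomial.C r) h
    rwa [MvPolynomial.C_mul_monomial, mul_one] at this
  classical
  induction m using Finsupp.induction_linear with
  | zero => simp
  | add m m' h h' =>
    rw [Finsupp.sum_add_index' (by simp) (by intros; exact add_smul _ _ _)]
    have := Ideal.mul_mem_mul h h'
    rw [MvPolynomial.monomial_mul, mul_one, ← pow_add] at this
    refine Ideal.pow_le_pow_right ?_ this
    simp only [Pi.add_apply]
    omega
  | single j e =>
    rw [Finsupp.sum_single_index (by simp)]
    rcases j with l | ⟨l, j⟩
    · have : (((e • reesShift κ (Sum.inl l)) : ι → ℤ) i).toNat = 0 := by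
        by_cases h : i = l <;> simp [reesShift, h]
      rw [this]
      simp
    · by_cases h : i = l
      · subst h
        have : (((e • reesShift κ (Sum.inr ⟨i, j⟩)) : ι → ℤ) i).toNat = e := by
          simp [reesShift]
        rw [this, ← MvPolynomial.X_pow_eq_monomial]
        exact Ideal.pow_mem_pow (Ideal.subset_span (Set.mem_range_self j)) _
      · have : (((e • reesShift κ (Sum.inr ⟨l, j⟩)) : ι → ℤ) i).toNat = 0 := by
          simp [reesShift, h]
        rw [this]
        simp

/-- If a power of the ideal of `i`-positive variables maps a finitely generated submodule of
`⨁ N tⁿ` into the extended Rees module, then the two agree in degrees that are large in the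
direction `i`, uniformly in the other directions. -/
theorem exists_forall_le_mem_of_pow_positiveIdeal_smul (i : ι) (p : ℕ)
    {D : Submodule (ReesPoly A κ) (ReesAmbient g N)} (hD : D.FG)
    (hp : ∀ q ∈ positiveIdeal A κ i ^ p, ∀ f ∈ D, q • f ∈ reesModule g N) :
    ∃ b : ℕ, ∀ f ∈ D, ∀ n : ι → ℤ, (b : ℤ) ≤ n i → f n ∈ idealFiltration (genIdeal g) N n := by
  obtain ⟨s, rfl⟩ := hD
  let β : ReesAmbient g N → ℕ := fun f => (Finsupp.support f).sup fun n => (n i).toNat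
  have key : ∀ f ∈ s, ∀ (r : ReesPoly A κ) (n : ι → ℤ), ((β f + p : ℕ) : ℤ) ≤ n i →
      (r • f) n ∈ idealFiltration (genIdeal g) N n := by
    intro f hf r n hn
    induction r using MvPolynomial.induction_on' with
    | add r r' h h' =>
      rw [add_smul]
      exact add_mem h h'
    | monomial m c =>
      by_cases h0 : f (n - m.sum fun j e => e • reesShift κ j) = 0
      · rw [LaurentModule.monomial_smul_apply, h0, smul_zero]
        exact zero_mem _
      · have h1 : ((n - m.sum fun j e => e • reesShift κ j) i).toNat ≤ β f :=
          Finset.le_sup (f := fun n : ι → ℤ => (n i).toNat) (Finsupp.mem_support_iff.2 h0)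
        refine hp _ (Ideal.pow_le_pow_right ?_ (monomial_mem_positiveIdeal_pow i m c)) f
          (Submodule.subset_span hf) n
        simp only [Pi.sub_apply] at h1
        omega
  refine ⟨s.sup β + p, fun f hf => ?_⟩
  suffices h : ∀ (r : ReesPoly A κ) (n : ι → ℤ), ((s.sup β + p : ℕ) : ℤ) ≤ n i →
      (r • f) n ∈ idealFiltration (genIdeal g) N n by
    intro n hn
    have := h 1 n hn
    rwa [one_smul] at this
  induction hf using Submodule.span_induction with
  | mem f hf =>
    intro r n hn
    have : β f ≤ s.sup β := Finset.le_sup hf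
    exact key f hf r n (by omega)
  | zero =>
    intro r n _
    rw [smul_zero]
    exact zero_mem _
  | add f f' _ _ h h' =>
    intro r n hn
    rw [smul_add]
    exact add_mem (h r n hn) (h' r n hn)
  | smul r' f _ h =>
    intro r n hn
    rw [smul_smul]
    exact h _ n hn

/-- Division by the variables `X` modulo powers of the product `U` of the inverse variables reduces
to division modulo `U`, so that one exponent `p` serves for all powers of `U`. -/
theorem pow_smul_mem_reesModule {X : ReesPoly A κ} {𝔱 : Ideal (ReesPoly A κ)} {p : ℕ}
    (hp : ∀ q ∈ 𝔱 ^ p, ∀ f ∈ reesModule g N,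
      (∃ f' ∈ reesModule g N, X • f = invProd A κ • f') →
        ∃ f' ∈ reesModule g N, q • f = invProd A κ • f')
    (c : ℕ) (w : ReesAmbient g N) (hw : invProd A κ ^ c • w ∈ reesModule g N)
    (hX : X • w ∈ reesModule g N) (q : ReesPoly A κ) (hq : q ∈ 𝔱 ^ (c * p)) :
    q • w ∈ reesModule g N := by
  induction c generalizing w q with
  | zero =>
    rw [pow_zero, one_smul] at hw
    exact Submodule.smul_mem _ _ hw
  | succ c ih =>
    rw [Nat.succ_mul, pow_add] at hq
    induction hq using Submodule.mul_induction_on' with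
    | mem_mul_mem q hq r hr =>
      rw [mul_smul]
      obtain ⟨f', hf', e⟩ := hp r hr _ hw ⟨invProd A κ ^ c • X • w, Submodule.smul_mem _ _ hX, by
        rw [smul_smul, smul_smul, smul_smul]; congr 1; ring⟩
      refine ih _ ?_ ?_ _ hq
      · suffices h : invProd A κ ^ c • r • w = f' from h ▸ hf'
        refine invProd_pow_smul_injective 1 ?_
        simp only [pow_one]
        rw [← e, smul_smul, smul_smul, smul_smul]
        congr 1
        ring
      · rw [smul_comm]
        exact Submodule.smul_mem _ _ hX
    | add q _ q' _ h h' =>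
      rw [add_smul]
      exact add_mem h h'

theorem linearCombination_X_smul_single (i : ι) [Fintype (κ i)] (v : κ i → A) (n : ι → ℤ) (y : N) :
    (Fintype.linearCombination A
        (fun j : κ i => (MvPolynomial.X (Sum.inr ⟨i, j⟩) : ReesPoly A κ)) v) •
        (LaurentModule.single n y : ReesAmbient g N) =
      LaurentModule.single (n + Pi.single i 1) ((Fintype.linearCombination A (g i) v) • y) := by
  rw [Fintype.linearCombination_apply, Fintype.linearCombination_apply, Finset.sum_smul,
    Finset.sum_smul, map_sum]
  refine Finset.sum_congr rfl fun j _ => ?_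
  rw [MvPolynomial.smul_eq_C_mul, mul_smul, LaurentModule.X_smul_single, LaurentModule.C_smul,
    smul_eq_mul, mul_smul, map_smul _ (v j)]
  rfl

/-- Rees's lemma: over a local ring with infinite residue field, an ideal of the family contains an
element that is Rees superficial for its index and avoids any finite set of primes not containing
the ideal. -/
theorem exists_isReesSuperficialAt [IsLocalRing A] [IsNoetherianRing A]
    [Infinite (IsLocalRing.ResidueField A)] [Module.Finite A N] (I : ι → Ideal A) (i : ι)
    {𝒯 : Set (Ideal A)} (hfin : 𝒯.Finite) (hP : ∀ P ∈ 𝒯, ¬ I i ≤ P) :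
    ∃ x, IsReesSuperficialAt I N i x ∧ ∀ P ∈ 𝒯, x ∉ P := by
  classical
  have hfg : ∀ l, ∃ (k : ℕ) (g : Fin k → A), Ideal.span (Set.range g) = I l := fun l =>
    Submodule.fg_iff_exists_fin_generating_family.1 (IsNoetherian.noetherian (I l))
  choose k g hg using hfg
  let κ : ι → Type := fun l => Fin (k l)
  have hgI : (genIdeal g : ι → Ideal A) = I := funext hg
  let S := ReesPoly A κ
  let F : Submodule S (ReesAmbient g N) := reesModule g N
  have hF : IsNoetherian S F := isNoetherian_of_fg_of_noetherian _ reesModule_fg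
  let UF : Submodule S F := LinearMap.range (LinearMap.lsmul S F (invProd A κ))
  have hfinAss := associatedPrimes.finite S (F ⧸ UF)
  let Φ : (κ i → A) →ₗ[A] S :=
    Fintype.linearCombination A fun j : κ i => (MvPolynomial.X (Sum.inr ⟨i, j⟩) : S)
  let φ : (κ i → A) →ₗ[A] A := Fintype.linearCombination A (g i)
  obtain ⟨v, hv⟩ := exists_forall_notMem_of_finite
    (s := (fun Q : Ideal S => (Q.restrictScalars A).comap Φ) ''
        {Q ∈ associatedPrimes S (F ⧸ UF) | ¬ positiveIdeal A κ i ≤ Q} ∪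
      (fun P : Ideal A => Submodule.comap φ P) '' 𝒯)
    (((hfinAss.subset (Set.sep_subset _ _)).image _).union (hfin.image _)) (by
      rintro (⟨Q, ⟨-, hQ⟩, h⟩ | ⟨P, hP', h⟩)
      · refine hQ (Ideal.span_le.2 ?_)
        rintro _ ⟨j, rfl⟩
        have : Pi.single j 1 ∈ (Q.restrictScalars A).comap Φ := h.ge Submodule.mem_top
        simpa [Φ, Fintype.linearCombination_apply_single] using this
      · refine hP P hP' ?_
        rw [← hg i, Ideal.span_le]
        rintro _ ⟨j, rfl⟩
        have : Pi.single j 1 ∈ Submodule.comap φ P := h.ge Submodule.mem_top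
        simpa [φ, Fintype.linearCombination_apply_single] using this)
  have hx : φ v ∈ I i := by
    rw [← hg i]
    simp only [φ, Fintype.linearCombination_apply]
    exact sum_mem fun j _ => Ideal.mul_mem_left _ _ (Ideal.subset_span ⟨j, rfl⟩)
  refine ⟨φ v, ⟨hx, ?_⟩, fun P hP' h => hv _ (Or.inr ⟨P, hP', rfl⟩) h⟩
  -- the generic combination `Φ v` of the variables acts almost injectively modulo `U`
  obtain ⟨p, hp⟩ := exists_pow_smul_eq_zero_of_associatedPrimes (K := F ⧸ UF) (Φ v)
    (positiveIdeal A κ i) (by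
      intro Q hQ hvQ
      by_contra hn
      exact hv _ (Or.inl ⟨Q, ⟨hQ, hn⟩, rfl⟩) hvQ)
  have hp' : ∀ q ∈ positiveIdeal A κ i ^ p, ∀ f ∈ reesModule g N,
      (∃ f' ∈ reesModule g N, Φ v • f = invProd A κ • f') →
        ∃ f' ∈ reesModule g N, q • f = invProd A κ • f' := by
    rintro q hq f hf ⟨f', hf', e⟩
    have := hp q hq (UF.mkQ ⟨f, hf⟩) (by
      rw [← map_smul, Submodule.mkQ_apply, Submodule.Quotient.mk_eq_zero]
      exact ⟨⟨f', hf'⟩, Subtype.ext e.symm⟩)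
    rw [← map_smul, Submodule.mkQ_apply, Submodule.Quotient.mk_eq_zero] at this
    obtain ⟨⟨f'', hf''⟩, e'⟩ := this
    exact ⟨f'', hf'', (congrArg Subtype.val e').symm⟩
  obtain ⟨c, hc⟩ := exists_smul_eq_of_smul_mem_reesModule (g := g) (N := N) (φ v)
  let E : Submodule S (ReesAmbient g N) :=
    F.comap (LinearMap.lsmul S (ReesAmbient g N) (invProd A κ ^ c))
  let D : Submodule S (ReesAmbient g N) :=
    E ⊓ F.comap (LinearMap.lsmul S (ReesAmbient g N) (Φ v))
  have hE : IsNoetherian S E := by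
    let ψ : E →ₗ[S] F :=
      (LinearMap.lsmul S (ReesAmbient g N) (invProd A κ ^ c)).restrict (fun f hf => hf)
    refine isNoetherian_of_injective ψ fun f f' h => Subtype.ext ?_
    exact invProd_pow_smul_injective c (congrArg Subtype.val h)
  obtain ⟨b, hb⟩ := exists_forall_le_mem_of_pow_positiveIdeal_smul i (c * p)
    (isNoetherian_submodule.1 hE D inf_le_left)
    (fun q hq f hf => pow_smul_mem_reesModule hp' c f hf.1 hf.2 q hq)
  refine ⟨b, fun n hn => le_antisymm ?_ ?_⟩
  · intro z hz
    obtain ⟨hz1, hz2⟩ := hz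
    rw [Submodule.ideal_span_singleton_smul] at hz1 ⊢
    obtain ⟨y₀, -, rfl⟩ := (Submodule.mem_smul_pointwise_iff_exists _ _ _).1 hz1
    let n' : ι → ℤ := fun l => n l
    have e₁ : idealFiltration I N n' = (∏ l, I l ^ n l) • ⊤ := by
      simp [idealFiltration, n']
    have e₂ : idealFiltration I N (n' + Pi.single i 1) =
        (∏ l, I l ^ Function.update n i (n i + 1) l) • ⊤ := by
      rw [idealFiltration]
      congr 2
      ext1 l
      by_cases h : l = i
      · subst h
        simp only [Pi.add_apply, Pi.single_eq_same, Function.update_self, n']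
        congr 1
      · simp [Function.update_of_ne h, Pi.single_eq_of_ne h, n']
    rw [← e₂, ← hgI] at hz2
    -- Artin–Rees replaces `y₀` by an element `y` of almost the right order
    obtain ⟨f', hf', hcf'⟩ := hc (LaurentModule.single (n' + Pi.single i 1) y₀) (by
      rw [← map_smul]
      exact single_mem_reesModule.2 hz2)
    set y := f' (n' + Pi.single i 1) with hy
    have hxy : φ v • y = φ v • y₀ := by
      have := congrArg (fun f : ReesAmbient g N => f (n' + Pi.single i 1)) hf'
      simpa using this
    have hyc := invProd_pow_smul_mem_reesModule.1 hcf' (n' + Pi.single i 1)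
    rw [← hy] at hyc
    have hD : (LaurentModule.single n' y : ReesAmbient g N) ∈ D := by
      refine ⟨invProd_pow_smul_mem_reesModule.2 fun m => ?_, ?_⟩
      · rw [LaurentModule.single_apply]
        split_ifs with h
        · subst h
          refine idealFiltration_antitone _ _ (sub_le_sub_right ?_ _) hyc
          exact le_add_of_nonneg_right (Pi.single_nonneg.2 zero_le_one)
        · exact zero_mem _
      · change Φ v • _ ∈ reesModule g N
        have e := linearCombination_X_smul_single (g := g) (κ := κ) i v n' y
        refine e.symm ▸ single_mem_reesModule.2 ?_
        change φ v • y ∈ _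
        rwa [hxy]
    have hyn := hb _ hD n' (Int.ofNat_le.2 hn)
    rw [LaurentModule.single_apply_self, hgI, e₁] at hyn
    exact (Submodule.mem_smul_pointwise_iff_exists _ _ _).2 ⟨y, hyn, hxy⟩
  · refine le_inf (Submodule.smul_mono le_rfl le_top) ?_
    rw [← Submodule.mul_smul]
    refine Submodule.smul_mono_left ?_
    rw [← Finset.mul_prod_erase _ _ (Finset.mem_univ i), ← Finset.mul_prod_erase _
      (fun l => I l ^ Function.update n i (n i + 1) l) (Finset.mem_univ i), ← mul_assoc,
      Function.update_self, pow_succ']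
    refine Ideal.mul_mono (Ideal.mul_mono_left ?_) (le_of_eq ?_)
    · rwa [Ideal.span_singleton_le_iff_mem]
    · refine Finset.prod_congr rfl fun l hl => ?_
      rw [Function.update_of_ne (Finset.ne_of_mem_erase hl)]

end Superficial

/-! ### Rees superficial sequences and joint reductions -/

section Sequences

variable {A : Type*} [CommRing A] {ι : Type*} [Fintype ι] [DecidableEq ι]
  {M : Type*} [AddCommGroup M] [Module A M]

theorem mul_prod_pow {I : ι → Ideal A} {i : ι} {n : ι → ℕ} :
    I i * ∏ l, I l ^ n l = ∏ l, I l ^ Function.update n i (n i + 1) l := by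
  rw [← Finset.mul_prod_erase _ _ (Finset.mem_univ i), ← Finset.mul_prod_erase _
    (fun l => I l ^ Function.update n i (n i + 1) l) (Finset.mem_univ i), ← mul_assoc,
    Function.update_self, pow_succ']
  congr 1
  refine Finset.prod_congr rfl fun l hl => ?_
  rw [Function.update_of_ne (Finset.ne_of_mem_erase hl)]

theorem update_update_succ (n : ι → ℕ) (i : ι) :
    Function.update (Function.update (fun l => n l + 1) i (n i)) i
      (Function.update (fun l => n l + 1) i (n i) i + 1) = fun l => n l + 1 := by
  rw [Function.update_self, Function.update_idem]
  exact Function.update_eq_self i _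

/-- The right-hand side of the defining equality of joint reductions is contained in the
left-hand side. -/
theorem iSup_span_smul_le (I : ι → Ideal A) (R : Set A) (n : ι → ℕ) :
    (⨆ i, Ideal.span (R ∩ (I i : Set A)) •
        ((∏ l, I l ^ Function.update (fun l => n l + 1) i (n i) l) • (⊤ : Submodule A M))) ≤
      (∏ l, I l ^ (n l + 1)) • (⊤ : Submodule A M) := by
  refine iSup_le fun i => ?_
  rw [← Submodule.mul_smul]
  refine Submodule.smul_mono_left ?_
  refine (Ideal.mul_mono_left (Ideal.span_le.2 Set.inter_subset_right)).trans (le_of_eq ?_)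
  rw [mul_prod_pow, update_update_succ]

/-- Along a Rees superficial sequence `x`, the elements of `(x) M` of high order in the filtration
can be written with coefficients of the expected order. -/
theorem exists_forall_inf_le_iSup {I : ι → Ideal A} {t : ℕ} {x : Fin t → A}
    (hx : IsReesSuperficialSeq I M x) :
    ∃ N : ℕ, ∀ n : ι → ℕ, (∀ i, N ≤ n i) →
      (∏ l, I l ^ (n l + 1)) • (⊤ : Submodule A M) ⊓
          Ideal.span (Set.range x) • (⊤ : Submodule A M) ≤
        ⨆ i, Ideal.span (Set.range x ∩ (I i : Set A)) •
          ((∏ l, I l ^ Function.update (fun l => n l + 1) i (n i) l) • (⊤ : Submodule A M)) := by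
  choose e he N hN using hx
  refine ⟨Finset.univ.sup N, fun n hn => ?_⟩
  set T := ⨆ i, Ideal.span (Set.range x ∩ (I i : Set A)) •
          ((∏ l, I l ^ Function.update (fun l => n l + 1) i (n i) l) • (⊤ : Submodule A M)) with hT
  suffices h : ∀ j ≤ t, (∏ l, I l ^ (n l + 1)) • (⊤ : Submodule A M) ⊓
      Ideal.span (x '' {l | (l : ℕ) < j}) • (⊤ : Submodule A M) ≤ T by
    have := h t le_rfl
    rwa [show {l : Fin t | (l : ℕ) < t} = Set.univ from Set.eq_univ_of_forall fun l => l.2,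
      Set.image_univ] at this
  intro j
  induction j with
  | zero =>
    intro _
    simp
  | succ j ih =>
    intro hj z hz
    obtain ⟨hz1, hz2⟩ := hz
    have ih := ih (by omega)
    let j' : Fin t := ⟨j, hj⟩
    have hset : x '' {l | (l : ℕ) < j + 1} = insert (x j') (x '' {l | l < j'}) := by
      rw [← Set.image_insert_eq]
      congr 1
      ext l
      simp only [Set.mem_ofPred_eq, Set.mem_insert_iff, Fin.lt_def, Fin.ext_iff, j']
      omega
    set P := precSubmodule x M j' with hP
    have hmap : ∀ 𝔞 : Ideal A, Submodule.map P.mkQ (𝔞 • (⊤ : Submodule A M)) = 𝔞 • ⊤ := by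
      intro 𝔞
      rw [Submodule.map_smul'', Submodule.map_top, Submodule.range_mkQ]
    rw [hset, Ideal.span_insert, Submodule.sup_smul] at hz2
    obtain ⟨z₁, hz₁, z₂, hz₂, rfl⟩ := Submodule.mem_sup.1 hz2
    have hmem : P.mkQ (z₁ + z₂) ∈ Ideal.span {x j'} •
        ((∏ l, I l ^ Function.update (fun l => n l + 1) (e j') (n (e j')) l) •
          (⊤ : Submodule A (M ⧸ P))) := by
      rw [← hN j' _ (by
        rw [Function.update_self]
        exact (Finset.le_sup (f := N) (Finset.mem_univ j')).trans (hn _)), update_update_succ]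
      refine ⟨?_, ?_⟩
      · have h0 : P.mkQ z₂ = 0 := (Submodule.Quotient.mk_eq_zero _).2 hz₂
        rw [map_add, h0, add_zero, ← hmap]
        exact Submodule.mem_map_of_mem hz₁
      · rw [← hmap]
        exact Submodule.mem_map_of_mem hz1
    rw [← hmap, ← Submodule.map_smul''] at hmem
    obtain ⟨w, hw, hwz⟩ := hmem
    have hwT : w ∈ T := by
      refine Submodule.mem_iSup_of_mem (e j') (Submodule.smul_mono_left (Ideal.span_mono ?_) hw)
      exact Set.singleton_subset_iff.2 ⟨⟨j', rfl⟩, he j'⟩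
    rw [← sub_add_cancel (z₁ + z₂) w]
    refine add_mem (ih ⟨sub_mem hz1 (iSup_span_smul_le I (Set.range x) n hwT), ?_⟩) hwT
    have : P.mkQ (z₁ + z₂ - w) = 0 := by rw [map_sub, hwz, sub_self]
    exact (Submodule.Quotient.mk_eq_zero _).1 this

end Sequences

section Local

variable {A : Type*} [CommRing A] [IsLocalRing A] [IsNoetherianRing A]
  {M : Type*} [AddCommGroup M] [Module A M]

theorem exists_pow_smul_top_eq_bot {J : Ideal A} (hJ : J ≤ IsLocalRing.maximalIdeal A)
    (hM : IsFiniteLength A M) : ∃ n : ℕ, J ^ n • (⊤ : Submodule A M) = ⊥ := by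
  obtain ⟨h1, h2⟩ := isFiniteLength_iff_isNoetherian_isArtinian.1 hM
  obtain ⟨n, hn⟩ := IsArtinian.monotone_stabilizes (R := A) (M := M)
    ⟨fun n => OrderDual.toDual (J ^ n • (⊤ : Submodule A M)), fun a b h =>
      Submodule.smul_mono_left (Ideal.pow_le_pow_right h)⟩
  refine ⟨n, Submodule.eq_bot_of_le_smul_of_le_jacobson_bot J _ (IsNoetherian.noetherian _) ?_
    (hJ.trans (IsLocalRing.maximalIdeal_le_jacobson _))⟩
  have : J ^ n • (⊤ : Submodule A M) = J ^ (n + 1) • (⊤ : Submodule A M) := hn (n + 1) (by omega)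
  rw [← Submodule.mul_smul, ← pow_succ']
  exact this.le

theorem supportDim_le_zero_of_isFiniteLength [Module.Finite A M] (hM : IsFiniteLength A M) :
    Module.supportDim A M ≤ 0 := by
  obtain ⟨n, hn⟩ := exists_pow_smul_top_eq_bot le_rfl hM
  have hle : IsLocalRing.maximalIdeal A ^ n ≤ Module.annihilator A M := by
    rw [← Submodule.annihilator_top]
    exact Submodule.le_annihilator_iff.2 hn
  have : Subsingleton (Module.support A M) := by
    suffices h : ∀ P ∈ Module.support A M, P = IsLocalRing.closedPoint A from
      ⟨fun P Q => Subtype.ext ((h P P.2).trans (h Q Q.2).symm)⟩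
    intro P hP
    have h1 := hle.trans (Module.mem_support_iff_of_finite.1 hP)
    refine PrimeSpectrum.ext ?_
    exact ((IsLocalRing.maximalIdeal.isMaximal A).eq_of_le P.2.ne_top
      (P.2.le_of_pow_le h1)).symm
  exact Order.krullDim_nonpos_of_subsingleton

theorem isFiniteLength_of_supportDim_le_zero [Module.Finite A M]
    (hM : Module.supportDim A M ≤ 0) : IsFiniteLength A M := by
  refine isFiniteLength_iff_isNoetherian_isArtinian.2 ⟨inferInstance, ?_⟩
  rw [Module.supportDim_eq_ringKrullDim_quotient_annihilator] at hM
  have : Ring.KrullDimLE 0 (A ⧸ Module.annihilator A M) := Ring.krullDimLE_iff.2 hM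
  have : IsArtinianRing (A ⧸ Module.annihilator A M) := isArtinianRing_iff_krullDimLE_zero.2 this
  let _ : Module (A ⧸ Module.annihilator A M) M :=
    (Module.isTorsionBySet_annihilator A M).module
  have : IsScalarTower A (A ⧸ Module.annihilator A M) M :=
    (Module.isTorsionBySet_annihilator A M).isScalarTower
  have : Module.Finite (A ⧸ Module.annihilator A M) M :=
    Module.Finite.of_restrictScalars_finite A _ _
  have : IsArtinian (A ⧸ Module.annihilator A M) M := isArtinian_of_fg_of_artinian'
  exact isArtinian_of_surjective_algebraMap (R := A ⧸ Module.annihilator A M)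
    Ideal.Quotient.mk_surjective

theorem supportDim_congr {N : Type*} [AddCommGroup N] [Module A N]
    (h : Module.support A M = Module.support A N) :
    Module.supportDim A M = Module.supportDim A N := by
  rw [Module.supportDim, Module.supportDim, h]

theorem supportDim_le_supportDim_quotient_add_card [Module.Finite A M] (s : Finset A)
    (hs : ∀ x ∈ s, x ∈ IsLocalRing.maximalIdeal A) :
    Module.supportDim A M ≤
      Module.supportDim A (M ⧸ Ideal.span (s : Set A) • (⊤ : Submodule A M)) + s.card := by
  classical
  induction s using Finset.induction_on with
  | empty =>
    have : Module.support A M =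
        Module.support A (M ⧸ Ideal.span ((∅ : Finset A) : Set A) • (⊤ : Submodule A M)) := by
      rw [Module.support_quotient]
      simp
    rw [← supportDim_congr this, Finset.card_empty, Nat.cast_zero, add_zero]
  | insert x s hx ih =>
    have h1 := ih fun y hy => hs y (Finset.mem_insert_of_mem hy)
    have h2 := Module.supportDim_le_supportDim_quotSMulTop_succ
      (M := M ⧸ Ideal.span (s : Set A) • (⊤ : Submodule A M)) (hs x (Finset.mem_insert_self x s))
    have h3 : Module.support A (QuotSMulTop x (M ⧸ Ideal.span (s : Set A) • (⊤ : Submodule A M))) =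
        Module.support A
          (M ⧸ Ideal.span ((insert x s : Finset A) : Set A) • (⊤ : Submodule A M)) := by
      rw [Module.support_quotSMulTop, Module.support_quotient, Module.support_quotient,
        Finset.coe_insert, PrimeSpectrum.zeroLocus_span, PrimeSpectrum.zeroLocus_span,
        Set.insert_eq, PrimeSpectrum.zeroLocus_union, Set.inter_assoc,
        Set.inter_comm (PrimeSpectrum.zeroLocus {x})]
    rw [supportDim_congr h3] at h2
    rw [Finset.card_insert_of_notMem hx, Nat.cast_add, Nat.cast_one, add_comm (s.card : WithBot ℕ∞),
      ← add_assoc]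
    exact h1.trans (add_le_add_left h2 _)

theorem IsSystemOfParameters.injective [Module.Finite A M] {d : ℕ} {x : Fin d → A}
    (hx : IsSystemOfParameters M x) : Function.Injective x := by
  classical
  obtain ⟨h1, h2, h3⟩ := hx
  have h := supportDim_le_supportDim_quotient_add_card (M := M) (Finset.univ.image x)
    (by simpa using h2)
  rw [Finset.coe_image, Finset.coe_univ, Set.image_univ, h1] at h
  have h' := h.trans (add_le_add_left (supportDim_le_zero_of_isFiniteLength h3) _)
  rw [zero_add] at h'
  have h'' : d ≤ (Finset.univ.image x).card := by exact_mod_cast h'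
  refine Set.injOn_univ.1 ?_
  rw [← Finset.coe_univ]
  exact Finset.injOn_of_card_image_eq (le_antisymm Finset.card_image_le (by simpa using h''))

/-- A Rees superficial sequence that is a system of parameters is a joint reduction as soon as one
ideal of the family is contained in the maximal ideal. -/
theorem isJointReduction_of_isReesSuperficialSeq [Module.Finite A M] {ι : Type*} [Fintype ι]
    [DecidableEq ι] {I : ι → Ideal A} {i₀ : ι} (hi₀ : I i₀ ≤ IsLocalRing.maximalIdeal A)
    {k : ι → ℕ} {d : ℕ} {x : Fin d → A} (hx : IsReesSuperficialSeq I M x) (hk : HasType I k x)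
    (hsop : IsSystemOfParameters M x) : IsJointReduction I M k (Set.range x) := by
  classical
  have hinj := hsop.injective
  obtain ⟨c, hc, hck⟩ := hk
  refine ⟨⟨Function.extend x c fun _ => i₀, ?_, fun i => ?_⟩, ?_⟩
  · rintro _ ⟨j, rfl⟩
    rw [hinj.extend_apply]
    exact hc j
  · rw [← hck i, ← Set.encard_coe_eq_coe_finsetCard, ← hinj.encard_image]
    congr 1
    ext a
    constructor
    · rintro ⟨⟨j, rfl⟩, h⟩
      rw [hinj.extend_apply] at h
      exact ⟨j, by simpa using h, rfl⟩
    · rintro ⟨j, hj, rfl⟩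
      refine ⟨⟨j, rfl⟩, ?_⟩
      rw [hinj.extend_apply]
      simpa using hj
  · obtain ⟨N, hN⟩ := exists_forall_inf_le_iSup hx
    obtain ⟨n₀, hn₀⟩ := exists_pow_smul_top_eq_bot hi₀ hsop.2.2
    refine ⟨max N n₀, fun n hn => le_antisymm ?_ (iSup_span_smul_le _ _ _)⟩
    refine le_trans (le_inf le_rfl ?_) (hN n fun i => (le_max_left _ _).trans (hn i))
    have h1 : I i₀ ^ n₀ • (⊤ : Submodule A M) ≤ Ideal.span (Set.range x) • ⊤ := by
      rw [← Submodule.ker_mkQ (Ideal.span (Set.range x) • (⊤ : Submodule A M)),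
        LinearMap.le_ker_iff_map, Submodule.map_smul'', Submodule.map_top, Submodule.range_mkQ]
      exact hn₀
    refine le_trans (Submodule.smul_mono_left ?_) h1
    refine (Ideal.prod_le_inf.trans (Finset.inf_le (Finset.mem_univ i₀))).trans ?_
    exact Ideal.pow_le_pow_right (((le_max_right _ _).trans (hn i₀)).trans (Nat.le_succ _))

end Local

/-! ### Superficial parameters -/

section Parameters

variable {A : Type*} [CommRing A] [IsLocalRing A] [IsNoetherianRing A]
  {M : Type*} [AddCommGroup M] [Module A M] [Module.Finite A M]

/-- If no chain of primes of maximal length in the support of `M` starts at a prime containing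
`I i`, then some Rees superficial element of `I i` drops the dimension of `M`. -/
theorem exists_isReesSuperficialAt_supportDim_le [Infinite (IsLocalRing.ResidueField A)]
    {ι : Type*} [Fintype ι] [DecidableEq ι] (I : ι → Ideal A) (i : ι) {e : ℕ}
    (hdim : Module.supportDim A M ≤ (e + 1 : ℕ))
    (hI : ∀ q : LTSeries (Module.support A M), I i ≤ q.head.1.asIdeal → q.length ≤ e) :
    ∃ x, IsReesSuperficialAt I M i x ∧
      Module.supportDim A (M ⧸ Ideal.span {x} • (⊤ : Submodule A M)) ≤ e := by
  obtain ⟨x, hx, hxP⟩ := exists_isReesSuperficialAt (N := M) I i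
    (𝒯 := {P ∈ (Module.annihilator A M).minimalPrimes | ¬ I i ≤ P})
    ((Ideal.finite_minimalPrimes_of_isNoetherianRing A _).subset (Set.sep_subset _ _))
    fun P hP => hP.2
  refine ⟨x, hx, iSup_le fun p => ?_⟩
  have hsupp := Module.support_quotient (M := M) (Ideal.span {x})
  have le : Module.support A (M ⧸ Ideal.span {x} • (⊤ : Submodule A M)) ⊆ Module.support A M :=
    hsupp ▸ Set.inter_subset_left
  let q : LTSeries (Module.support A M) := p.map (Set.inclusion le) fun _ _ h => h
  have hq : q.length = p.length := rfl
  have hqx : x ∈ q.head.1.asIdeal := by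
    have := hsupp.le p.head.2
    exact this.2 (Ideal.mem_span_singleton_self x)
  rw [← hq]
  by_contra hlt
  have hlt : e < q.length := by
    rw [not_le] at hlt
    exact_mod_cast hlt
  obtain ⟨r, hrm, hr⟩ := Ideal.exists_minimalPrimes_le
    (Module.mem_support_iff_of_finite.1 q.head.2)
  -- a chain of maximal length starts at a minimal prime
  rcases eq_or_lt_of_le hr with h | h
  · refine hxP r ⟨hrm, fun hle => ?_⟩ (h ▸ hqx)
    exact absurd (hI q (h ▸ hle)) (by omega)
  · let r' : Module.support A M :=
      ⟨⟨r, hrm.isPrime⟩, Module.mem_support_iff_of_finite.2 hrm.1.2⟩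
    have h1 : ((q.cons r' h).length : WithBot ℕ∞) ≤ Module.supportDim A M := le_iSup
      (fun p : LTSeries (Module.support A M) => (p.length : WithBot ℕ∞)) (q.cons r' h)
    have h2 : (q.cons r' h).length ≤ e + 1 := by exact_mod_cast h1.trans hdim
    simp only [RelSeries.cons_length] at h2
    omega

theorem support_quotient_span_insert (x : A) (s : Set A) :
    Module.support A ((M ⧸ Ideal.span s • (⊤ : Submodule A M)) ⧸
        Ideal.span {x} • (⊤ : Submodule A (M ⧸ Ideal.span s • (⊤ : Submodule A M)))) =
      Module.support A (M ⧸ Ideal.span (insert x s) • (⊤ : Submodule A M)) := by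
  rw [Module.support_quotient, Module.support_quotient, Module.support_quotient,
    PrimeSpectrum.zeroLocus_span, PrimeSpectrum.zeroLocus_span, PrimeSpectrum.zeroLocus_span,
    Set.insert_eq, PrimeSpectrum.zeroLocus_union, Set.inter_assoc,
    Set.inter_comm (PrimeSpectrum.zeroLocus {x})]

/-- Iterated choice of superficial elements, each of which drops the dimension. -/
theorem exists_isReesSuperficialAt_seq [Infinite (IsLocalRing.ResidueField A)]
    {ι : Type*} [Fintype ι] [DecidableEq ι] (I : ι → Ideal A) (c : ℕ → ι) {d : ℕ}
    (hdim : Module.supportDim A M ≤ d)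
    (hI : ∀ j < d, ∀ q : LTSeries (Module.support A M),
      I (c j) ≤ q.head.1.asIdeal → q.length + j < d) :
    ∀ t ≤ d, ∃ x : ℕ → A,
      (∀ j < t, IsReesSuperficialAt I
        (M ⧸ Ideal.span (x '' {l | l < j}) • (⊤ : Submodule A M)) (c j) (x j)) ∧
      Module.supportDim A (M ⧸ Ideal.span (x '' {l | l < t}) • (⊤ : Submodule A M)) ≤
        (d - t : ℕ) := by
  intro t
  induction t with
  | zero =>
    intro _
    refine ⟨fun _ => 0, by simp, (le_of_eq (supportDim_congr ?_)).trans hdim⟩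
    rw [Module.support_quotient]
    simp
  | succ t ih =>
    intro ht
    obtain ⟨x, hx, hxd⟩ := ih (by omega)
    rw [show d - t = (d - (t + 1)) + 1 by omega] at hxd
    have le : Module.support A (M ⧸ Ideal.span (x '' {l | l < t}) • (⊤ : Submodule A M)) ⊆
        Module.support A M := by
      rw [Module.support_quotient]
      exact Set.inter_subset_left
    obtain ⟨y, hy, hyd⟩ := exists_isReesSuperficialAt_supportDim_le I (c t) hxd (by
      intro q hq
      have : q.length + t < d := hI t (by omega) (q.map (Set.inclusion le) fun _ _ h => h) hq
      omega)
    have himg : ∀ j ≤ t, Function.update x t y '' {l | l < j} = x '' {l | l < j} := by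
      intro j hj
      refine Set.image_congr fun l hl => Function.update_of_ne (Nat.ne_of_lt ?_) _ _
      exact lt_of_lt_of_le hl hj
    refine ⟨Function.update x t y, fun j hj => ?_, ?_⟩
    · rw [himg j (by omega)]
      rcases Nat.lt_succ_iff_lt_or_eq.1 hj with h | rfl
      · rw [Function.update_of_ne h.ne]
        exact hx j h
      · rwa [Function.update_self]
    · have hset : Function.update x t y '' {l | l < t + 1} = insert y (x '' {l | l < t}) := by
        rw [← himg t le_rfl, show {l | l < t + 1} = insert t {l | l < t} by ext l; simp; omega,
          Set.image_insert_eq, Function.update_self]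
      rw [hset, ← supportDim_congr (support_quotient_span_insert y _)]
      exact hyd

theorem length_add_le_of_le_height {d j : ℕ} (hdim : Module.supportDim A M = d) {𝔞 : Ideal A}
    (hj : (j : ℕ∞) ≤ (𝔞.map (Ideal.Quotient.mk (Module.annihilator A M))).height)
    (q : LTSeries (Module.support A M)) (hq : 𝔞 ≤ q.head.1.asIdeal) : q.length + j ≤ d := by
  let e : PrimeSpectrum (A ⧸ Module.annihilator A M) ≃o Module.support A M :=
    (Module.annihilator A M).primeSpectrumQuotientOrderIsoZeroLocus.trans
      (OrderIso.setCongr _ _ Module.support_eq_zeroLocus.symm)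
  obtain ⟨P, hP⟩ := e.surjective q.head
  have hle : 𝔞.map (Ideal.Quotient.mk (Module.annihilator A M)) ≤ P.asIdeal := by
    rw [Ideal.map_le_iff_le_comap]
    rw [← hP] at hq
    exact hq
  have h1 : (j : ℕ∞) ≤ Order.height q.head := by
    rw [← hP, Order.height_orderIso, ← PrimeSpectrum.height_eq_orderHeight]
    exact hj.trans (Ideal.height_mono hle)
  obtain ⟨p, hp, hpj⟩ := Order.exists_series_of_le_height _ h1
  have h2 : ((p.smash q hp).length : WithBot ℕ∞) ≤ Module.supportDim A M := le_iSup
    (fun p : LTSeries (Module.support A M) => (p.length : WithBot ℕ∞)) (p.smash q hp)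
  rw [hdim] at h2
  have h3 : (p.smash q hp).length ≤ d := by exact_mod_cast h2
  simp only [RelSeries.smash_length] at h3
  omega

theorem length_eq_zero_of_radical_eq {J : Ideal A} (hJ : J.radical = IsLocalRing.maximalIdeal A)
    (q : LTSeries (Module.support A M)) (hq : J ≤ q.head.1.asIdeal) : q.length = 0 := by
  by_contra h
  have hlt : q.head < q.last := q.strictMono (Fin.pos_iff_ne_zero.2 fun h' => h (by
    simpa using congrArg Fin.val h'))
  have h1 : IsLocalRing.maximalIdeal A ≤ q.head.1.asIdeal :=
    hJ ▸ q.head.1.isPrime.radical_le_iff.2 hq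
  exact absurd (h1.trans_lt hlt) (IsLocalRing.le_maximalIdeal q.last.1.isPrime.ne_top).not_gt

end Parameters

/-- The assignment of indices that runs through the indices below `s` first, taking `i` exactly
`k i` times, and then through the last index. -/
def blockIndex {s : ℕ} (k : Fin s → ℕ) (k₀ : ℕ) : Fin (∑ i, k i + (k₀ + 1)) → Fin (s + 1) :=
  Fin.addCases (fun j => (finSigmaFinEquiv.symm j).1.castSucc) fun _ => Fin.last s

theorem card_filter_blockIndex {s : ℕ} (k : Fin s → ℕ) (k₀ : ℕ) (i : Fin (s + 1)) :
    (Finset.univ.filter fun j => blockIndex k k₀ j = i).card =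
      (Fin.snoc k (k₀ + 1) : Fin (s + 1) → ℕ) i := by
  rw [Finset.card_filter, Fin.sum_univ_add]
  simp only [blockIndex, Fin.addCases_left, Fin.addCases_right]
  rw [Equiv.sum_comp finSigmaFinEquiv.symm
    (fun a : Σ i, Fin (k i) => if a.1.castSucc = i then 1 else 0), Fintype.sum_sigma]
  induction i using Fin.lastCases with
  | last => simp [Fin.castSucc_ne_last]
  | cast i => simp [(Fin.castSucc_ne_last i).symm]

end JointRed

theorem corollary2p5 {A : Type*} [CommRing A] [IsLocalRing A] [IsNoetherianRing A]
    [Infinite (IsLocalRing.ResidueField A)]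
    {M : Type*} [AddCommGroup M] [Module A M] [Module.Finite A M]
    (d : ℕ) (hd : 0 < d) (hM : Module.supportDim A M = d)
    (J : Ideal A) (hJ : J.radical = IsLocalRing.maximalIdeal A)
    (s : ℕ) (I : Fin s → Ideal A)
    (h : ℕ∞)
    (hh : ((∏ i, I i).map (Ideal.Quotient.mk (Module.annihilator A M))).height = h)
    (hpos : 0 < h)
    (k₀ : ℕ) (k : Fin s → ℕ)
    (hsum : k₀ + ∑ i, k i = d - 1)
    (hlt : ((∑ i, k i : ℕ) : ℕ∞) < h)
    (hproper : ∀ i, 0 < k i → I i ≠ ⊤) :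
    let 𝓘 : Fin (s + 1) → Ideal A := Fin.snoc I J
    let κ : Fin (s + 1) → ℕ := Fin.snoc k (k₀ + 1)
    (∃ (x : Fin d → A) (c : Fin d → Fin (s + 1)),
      JointRed.IsReesSuperficialSeqAlong 𝓘 M c x ∧ JointRed.IsDistribution 𝓘 κ x c ∧
        JointRed.IsSystemOfParameters M x) ∧
    ∀ x : Fin d → A,
      JointRed.IsReesSuperficialSeq 𝓘 M x → JointRed.HasType 𝓘 κ x →
        JointRed.IsSystemOfParameters M x →
          JointRed.IsJointReduction 𝓘 M κ (Set.range x) := by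
  intro 𝓘 κ
  have hJm : J ≤ IsLocalRing.maximalIdeal A := hJ ▸ Ideal.le_radical
  have hlast : 𝓘 (Fin.last s) = J := by simp [𝓘]
  refine ⟨?_, fun x hx hk hsop => JointRed.isJointReduction_of_isReesSuperficialSeq
    (i₀ := Fin.last s) (hlast.trans_le hJm) hx hk hsop⟩
  obtain rfl : d = ∑ i, k i + (k₀ + 1) := by omega
  set d := ∑ i, k i + (k₀ + 1) with hd'
  let c : Fin d → Fin (s + 1) := JointRed.blockIndex k k₀
  have hc : ∀ j, 𝓘 (c j) ≤ IsLocalRing.maximalIdeal A ∧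
      ∀ q : LTSeries (Module.support A M), 𝓘 (c j) ≤ q.head.1.asIdeal → q.length + j < d := by
    intro j
    induction j using Fin.addCases with
    | left j =>
      let a := finSigmaFinEquiv.symm j
      have hcj : 𝓘 (c (Fin.castAdd _ j)) = I a.1 := by
        simp [c, JointRed.blockIndex, 𝓘, a]
      rw [hcj]
      refine ⟨IsLocalRing.le_maximalIdeal (hproper _ a.2.pos), fun q hq => ?_⟩
      have hj : ((j + 1 : ℕ) : ℕ∞) ≤ ((∏ i, I i).map
          (Ideal.Quotient.mk (Module.annihilator A M))).height := by
        rw [hh]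
        exact le_trans (by exact_mod_cast j.2) hlt.le
      have := JointRed.length_add_le_of_le_height hM hj q
        ((Ideal.prod_le_inf.trans (Finset.inf_le (Finset.mem_univ a.1))).trans hq)
      simp only [Fin.val_castAdd]
      omega
    | right j =>
      have hcj : 𝓘 (c (Fin.natAdd _ j)) = J := by
        simp [c, JointRed.blockIndex, 𝓘]
      rw [hcj]
      refine ⟨hJm, fun q hq => ?_⟩
      rw [JointRed.length_eq_zero_of_radical_eq hJ q hq, zero_add]
      exact (Fin.natAdd _ j).2
  let c' : ℕ → Fin (s + 1) := fun j => if h : j < d then c ⟨j, h⟩ else Fin.last s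
  have hc' : ∀ j : Fin d, c' j = c j := fun j => dif_pos j.2
  obtain ⟨x, hx, hxd⟩ := JointRed.exists_isReesSuperficialAt_seq (M := M) 𝓘 c' hM.le
    (fun j hj q hq => (hc ⟨j, hj⟩).2 q (by rwa [← hc' ⟨j, hj⟩])) d le_rfl
  have himg : ∀ j : Fin d, (fun l : Fin d => x l) '' {l | l < j} = x '' {l | l < (j : ℕ)} := by
    intro j
    ext a
    constructor
    · rintro ⟨l, hl, rfl⟩
      exact ⟨l, hl, rfl⟩
    · rintro ⟨l, hl, rfl⟩
      exact ⟨⟨l, lt_trans hl j.2⟩, hl, rfl⟩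
  have hrange : Set.range (fun l : Fin d => x l) = x '' {l | l < d} := by
    ext a
    constructor
    · rintro ⟨l, rfl⟩
      exact ⟨l, l.2, rfl⟩
    · rintro ⟨l, hl, rfl⟩
      exact ⟨⟨l, hl⟩, rfl⟩
  have hseq : JointRed.IsReesSuperficialSeqAlong 𝓘 M c fun l : Fin d => x l := by
    intro j
    have := hx j j.2
    rwa [hc', ← himg] at this
  refine ⟨fun l => x l, c, hseq, ⟨fun j => (hseq j).1, JointRed.card_filter_blockIndex k k₀⟩,
    hM, fun j => (hc j).1 (hseq j).1, ?_⟩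
  rw [hrange]
  rw [Nat.sub_self] at hxd
  exact JointRed.isFiniteLength_of_supportDim_le_zero (by exact_mod_cast hxd)
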